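/- Let $\mathbb{F}$ be the free group on two generators. All Hilbert spaces in the following definition and conjecture are complex and separable. A representation $\zeta:\mathbb{F}\times\mathbb{F}\to\mathrm{GL}(\mathscr{Y})$ by bounded invertible operators on a Hilbert space $\mathscr{Y}$ is called half finite if there are a finite quotient $\Pi:\mathbb{F}\twoheadrightarrow\Gamma$ and a representation $\zeta_\bullet:\Gamma\times\mathbb{F}\to\mathrm{GL}(\mathscr{Y})$ with $\zeta=\zeta_\bullet\circ(\Pi\times\mathrm{id}_{\mathbb{F}})$. Half finite approximation conjecture: for every Hilbert space $\mathscr{X}$, every unitary representation $\rho:\mathbb{F}\times\mathbb{F}\to\mathrm{U}(\mathscr{X})$, every unit vector $x\in\mathscr{X}$, all finite subsets $E,F\subseteq\mathbb{F}$ and every $\epsilon>0$, there exist a Hilbert space $\mathscr{Y}$, a half finite unitary representation $\zeta:\mathbb{F}\times\mathbb{F}\to\mathrm{U}(\mathscr{Y})$ and a unit vector $y\in\mathscr{Y}$ such that \[ |\langle\rho(g,g')x,x\rangle-\langle\zeta(g,g')y,y\rangle|\le\epsilon\qquad\text{for all } g\in E,\ g'\in F. \] Let $C^*(\mathbb{F})$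 be the full group $C^*$-algebra of $\mathbb{F}$, and let $\otimes_{\max}$ and $\otimes_{\min}$ denote the maximal and the minimal (spatial) tensor product of $C^*$-algebras. Theorem. If the half finite approximation conjecture holds, then Connes' embedding conjecture holds in the form \[ C^*(\mathbb{F})\otimes_{\max}C^*(\mathbb{F})=C^*(\mathbb{F})\otimes_{\min}C^*(\mathbb{F}), \] that is, the identity map of the algebraic tensor product $C^*(\mathbb{F})\odot C^*(\mathbb{F})$ extends to a $*$-isomorphism of the maximal tensor product onto the minimal tensor product. -/

import Mathlib

open scoped TensorProduct

noncomputable section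

universe u v

/-! ### Completing a complex `*`-algebra with respect to a `C*`-seminorm -/

/-- A `C*`-seminorm on a complex `*`-algebra. -/
structure CStarSeminorm (R : Type u) [Ring R] [StarRing R] [Algebra ℂ R] extends
    Seminorm ℂ R where
  mul_le' : ∀ a b : R, toFun (a * b) ≤ toFun a * toFun b
  star_mul_self' : ∀ a : R, toFun (star a * a) = toFun a ^ 2

namespace CStarSeminorm

variable {R : Type u} [Ring R] [StarRing R] [Algebra ℂ R]

theorem le_star (p : CStarSeminorm R) (a : R) :
    p.toSeminorm a ≤ p.toSeminorm (star a) := by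
  have h1 : p.toSeminorm (star a * a) = p.toSeminorm a ^ 2 := p.star_mul_self' a
  have h2 : p.toSeminorm (star a * a) ≤ p.toSeminorm (star a) * p.toSeminorm a :=
    p.mul_le' (star a) a
  have h3 : 0 ≤ p.toSeminorm a := apply_nonneg _ _
  have h4 : 0 ≤ p.toSeminorm (star a) := apply_nonneg _ _
  rcases h3.eq_or_lt with h | h
  · rw [← h]; exact h4
  · nlinarith

theorem star_eq (p : CStarSeminorm R) (a : R) :
    p.toSeminorm (star a) = p.toSeminorm a :=
  le_antisymm (by simpa using p.le_star (star a)) (p.le_star a)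

/-- The `C*`-seminorm `a ↦ sup_i ‖f i a‖` of a pointwise bounded family of `*`-homomorphisms
into `C*`-algebras. -/
def ofFamily {ι : Type v} {B : ι → Type u} [∀ i, CStarAlgebra (B i)]
    (f : ∀ i, R →⋆ₐ[ℂ] B i) (hf : ∀ a, BddAbove (Set.range fun i => ‖f i a‖)) :
    CStarSeminorm R where
  toFun a := ⨆ i, ‖f i a‖
  map_zero' := by simp
  add_le' a b := by
    refine Real.iSup_le (fun i => ?_) (add_nonneg (Real.iSup_nonneg fun _ => norm_nonneg _)
      (Real.iSup_nonneg fun _ => norm_nonneg _))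
    rw [map_add]
    exact (norm_add_le _ _).trans (add_le_add (le_ciSup (hf a) i) (le_ciSup (hf b) i))
  neg' a := by simp
  smul' c a := by
    simp only [map_smul, norm_smul]
    rw [Real.mul_iSup_of_nonneg (norm_nonneg c)]
  mul_le' a b := by
    have ha : 0 ≤ ⨆ i, ‖f i a‖ := Real.iSup_nonneg fun _ => norm_nonneg _
    have hb : 0 ≤ ⨆ i, ‖f i b‖ := Real.iSup_nonneg fun _ => norm_nonneg _
    refine Real.iSup_le (fun i => ?_) (mul_nonneg ha hb)
    rw [map_mul]
    exact (norm_mul_le _ _).trans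
      (mul_le_mul (le_ciSup (hf a) i) (le_ciSup (hf b) i) (norm_nonneg _) ha)
  star_mul_self' a := by
    have ha : 0 ≤ ⨆ i, ‖f i a‖ := Real.iSup_nonneg fun _ => norm_nonneg _
    have key : ∀ i, ‖f i (star a * a)‖ = ‖f i a‖ ^ 2 := fun i => by
      rw [map_mul, map_star, CStarRing.norm_star_mul_self, sq]
    have hs : 0 ≤ ⨆ i, ‖f i (star a * a)‖ := Real.iSup_nonneg fun _ => norm_nonneg _
    refine le_antisymm (Real.iSup_le (fun i => ?_) (sq_nonneg _)) ?_
    · rw [key]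
      exact pow_le_pow_left₀ (norm_nonneg _) (le_ciSup (hf a) i) 2
    · have : (⨆ i, ‖f i a‖) ≤ √(⨆ i, ‖f i (star a * a)‖) := by
        refine Real.iSup_le (fun i => Real.le_sqrt_of_sq_le ?_) (Real.sqrt_nonneg _)
        rw [← key]
        exact le_ciSup (hf (star a * a)) i
      calc (⨆ i, ‖f i a‖) ^ 2 ≤ (√(⨆ i, ‖f i (star a * a)‖)) ^ 2 :=
            pow_le_pow_left₀ ha this 2
        _ = _ := Real.sq_sqrt hs

/-- The algebra `R` itself, regarded as a seminormed algebra with the seminorm `p`. -/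
def Pre (_p : CStarSeminorm R) : Type u := R

variable (p : CStarSeminorm R)

instance : Ring p.Pre := inferInstanceAs (Ring R)
instance : Algebra ℂ p.Pre := inferInstanceAs (Algebra ℂ R)
instance : StarRing p.Pre := inferInstanceAs (StarRing R)
instance [StarModule ℂ R] : StarModule ℂ p.Pre := inferInstanceAs (StarModule ℂ R)

instance : SeminormedRing p.Pre where
  toRing := inferInstance
  toPseudoMetricSpace :=
    (AddGroupSeminorm.toSeminormedAddCommGroup p.toSeminorm.toAddGroupSeminorm).toPseudoMetricSpace
  norm a := p.toSeminorm a
  dist_eq :=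
    (AddGroupSeminorm.toSeminormedAddCommGroup p.toSeminorm.toAddGroupSeminorm).dist_eq
  norm_mul_le := p.mul_le'

theorem norm_pre (a : p.Pre) : ‖a‖ = p.toSeminorm a := rfl

instance : NormedAlgebra ℂ p.Pre where
  toAlgebra := inferInstance
  norm_smul_le c a := (map_smul_eq_mul p.toSeminorm c a).le

instance : NormedStarGroup p.Pre where
  norm_star_le a := (p.star_eq a).le

/-- The Hausdorff completion of `R` with respect to the `C*`-seminorm `p` (the null space of `p`
is divided out). -/
abbrev Completion : Type u := UniformSpace.Completion p.Pre

instance : Star p.Completion where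
  star := UniformSpace.Completion.map star

theorem uniformContinuous_star_pre : UniformContinuous (star : p.Pre → p.Pre) :=
  (starNormedAddGroupHom : NormedAddGroupHom p.Pre p.Pre).uniformContinuous

theorem star_coe (a : p.Pre) : star (a : p.Completion) = ((star a : p.Pre) : p.Completion) :=
  UniformSpace.Completion.map_coe p.uniformContinuous_star_pre a

theorem continuous_star_completion : Continuous (star : p.Completion → p.Completion) :=
  UniformSpace.Completion.continuous_map

instance [StarModule ℂ R] : CStarAlgebra p.Completion where
  star_involutive x := by
    have hc := p.continuous_star_completion
    induction x using UniformSpace.Completion.induction_on with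
    | hp => exact isClosed_eq (hc.comp hc) continuous_id
    | ih a => rw [star_coe, star_coe, star_star]
  star_mul x y := by
    have hc := p.continuous_star_completion
    induction x, y using UniformSpace.Completion.induction_on₂ with
    | hp =>
      exact isClosed_eq (hc.comp (continuous_fst.mul continuous_snd))
        ((hc.comp continuous_snd).mul (hc.comp continuous_fst))
    | ih a b =>
      rw [← UniformSpace.Completion.coe_mul, star_coe, star_coe, star_coe, star_mul,
        UniformSpace.Completion.coe_mul]
  star_add x y := by
    have hc := p.continuous_star_completion
    induction x, y using UniformSpace.Completion.induction_on₂ with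
    | hp =>
      exact isClosed_eq (hc.comp (continuous_fst.add continuous_snd))
        ((hc.comp continuous_fst).add (hc.comp continuous_snd))
    | ih a b =>
      rw [← UniformSpace.Completion.coe_add, star_coe, star_coe, star_coe, star_add,
        UniformSpace.Completion.coe_add]
  norm_mul_self_le x := by
    have hc := p.continuous_star_completion
    induction x using UniformSpace.Completion.induction_on with
    | hp =>
      exact isClosed_le (continuous_norm.mul continuous_norm)
        (continuous_norm.comp (hc.mul continuous_id))
    | ih a =>
      rw [star_coe, ← UniformSpace.Completion.coe_mul, UniformSpace.Completion.norm_coe,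
        UniformSpace.Completion.norm_coe, ← sq]
      exact (p.star_mul_self' a).ge
  norm_smul_le := norm_smul_le
  star_smul c x := by
    have hc := p.continuous_star_completion
    induction x using UniformSpace.Completion.induction_on with
    | hp => exact isClosed_eq (hc.comp (continuous_const_smul c)) ((continuous_const_smul (star c)).comp hc)
    | ih a =>
      rw [← UniformSpace.Completion.coe_smul, star_coe, star_coe, star_smul,
        UniformSpace.Completion.coe_smul]

/-- The canonical `*`-homomorphism of `R` to its completion. -/
def toCompletion : R →⋆ₐ[ℂ] p.Completion where
  toFun a := ((show p.Pre from a) : p.Completion)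
  map_one' := UniformSpace.Completion.coe_one p.Pre
  map_mul' a b := UniformSpace.Completion.coe_mul (α := p.Pre) a b
  map_zero' := UniformSpace.Completion.coe_zero (α := p.Pre)
  map_add' a b := UniformSpace.Completion.coe_add (α := p.Pre) a b
  commutes' _ := rfl
  map_star' a := (p.star_coe a).symm

theorem norm_toCompletion (a : R) : ‖p.toCompletion a‖ = p.toSeminorm a :=
  UniformSpace.Completion.norm_coe (E := p.Pre) a

end CStarSeminorm

/-! ### The full group `C*`-algebra -/

/-- A unitary representation of the group `G` on a complex Hilbert space. -/
structure UnitaryRep (G : Type u) [Group G] : Type (u + 1) where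
  space : Type u
  [normed : NormedAddCommGroup space]
  [innerProduct : InnerProductSpace ℂ space]
  [complete : CompleteSpace space]
  rep : G →* unitary (space →L[ℂ] space)

attribute [instance] UnitaryRep.normed UnitaryRep.innerProduct UnitaryRep.complete

section GroupAlgebra

variable {G : Type u} [Group G]

/-- The involution `(∑ α_g g)* = ∑ conj(α_g) g⁻¹` of the group ring `ℂ[G]`. -/
instance groupRingStar : Star (MonoidAlgebra ℂ G) where
  star φ := φ.coeff.sum fun g c => MonoidAlgebra.single g⁻¹ (star c)

theorem groupRing_star_def (φ : MonoidAlgebra ℂ G) :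
    star φ = φ.coeff.sum fun g c => MonoidAlgebra.single g⁻¹ (star c) := rfl

theorem groupRing_star_single (g : G) (c : ℂ) :
    star (MonoidAlgebra.single g c : MonoidAlgebra ℂ G) = MonoidAlgebra.single g⁻¹ (star c) := by
  rw [groupRing_star_def, MonoidAlgebra.coeff_single, Finsupp.sum_single_index]
  simp

theorem groupRing_star_add (φ ψ : MonoidAlgebra ℂ G) : star (φ + ψ) = star φ + star ψ := by
  simp only [groupRing_star_def, MonoidAlgebra.coeff_add]
  exact Finsupp.sum_add_index' (by simp) (by simp [MonoidAlgebra.single_add])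

theorem groupRing_star_zero : star (0 : MonoidAlgebra ℂ G) = 0 := by
  simp [groupRing_star_def]

instance groupRingStarRing : StarRing (MonoidAlgebra ℂ G) where
  star_involutive φ := by
    induction φ using MonoidAlgebra.induction_linear with
    | zero => simp only [groupRing_star_zero]
    | add φ ψ h1 h2 => rw [groupRing_star_add, groupRing_star_add, h1, h2]
    | single g c => simp [groupRing_star_single]
  star_mul φ ψ := by
    induction φ using MonoidAlgebra.induction_linear with
    | zero => simp only [groupRing_star_zero, zero_mul, mul_zero]
    | add φ φ' h1 h2 => rw [add_mul, groupRing_star_add, groupRing_star_add, h1, h2, mul_add]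
    | single g c =>
      induction ψ using MonoidAlgebra.induction_linear with
      | zero => simp only [groupRing_star_zero, zero_mul, mul_zero]
      | add ψ ψ' h1 h2 => rw [mul_add, groupRing_star_add, groupRing_star_add, h1, h2, add_mul]
      | single h d =>
        simp [groupRing_star_single, MonoidAlgebra.single_mul_single, mul_comm]
  star_add := groupRing_star_add

instance groupRingStarModule : StarModule ℂ (MonoidAlgebra ℂ G) where
  star_smul c φ := by
    induction φ using MonoidAlgebra.induction_linear with
    | zero => simp only [smul_zero, groupRing_star_zero]
    | add φ φ' h1 h2 => rw [smul_add, groupRing_star_add, groupRing_star_add, h1, h2, smul_add]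
    | single g d => simp [groupRing_star_single, MonoidAlgebra.smul_single]

/-- The `*`-homomorphism `∑ α_g g ↦ ∑ α_g ρ(g)` of the group ring given by a unitary
representation. -/
def UnitaryRep.groupRingHom (ρ : UnitaryRep G) :
    MonoidAlgebra ℂ G →⋆ₐ[ℂ] (ρ.space →L[ℂ] ρ.space) where
  toAlgHom := MonoidAlgebra.lift ℂ (ρ.space →L[ℂ] ρ.space) G
    ((unitary (ρ.space →L[ℂ] ρ.space)).subtype.comp ρ.rep)
  map_star' φ := by
    change MonoidAlgebra.lift ℂ _ G _ (star φ) = star (MonoidAlgebra.lift ℂ _ G _ φ)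
    induction φ using MonoidAlgebra.induction_linear with
    | zero => rw [groupRing_star_zero, map_zero, star_zero]
    | add φ ψ h1 h2 => rw [groupRing_star_add, map_add, h1, h2, map_add, star_add]
    | single g c =>
      rw [groupRing_star_single, MonoidAlgebra.lift_single, MonoidAlgebra.lift_single, star_smul]
      congr 1
      change ((ρ.rep g⁻¹ : unitary _) : ρ.space →L[ℂ] ρ.space) = star (ρ.rep g : _ →L[ℂ] _)
      rw [map_inv]
      rfl

theorem UnitaryRep.groupRingHom_single (ρ : UnitaryRep G) (g : G) (c : ℂ) :
    ρ.groupRingHom (MonoidAlgebra.single g c) = c • (ρ.rep g : ρ.space →L[ℂ] ρ.space) :=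
  MonoidAlgebra.lift_single _ _ _

theorem UnitaryRep.bddAbove (φ : MonoidAlgebra ℂ G) :
    BddAbove (Set.range fun ρ : UnitaryRep G => ‖ρ.groupRingHom φ‖) := by
  induction φ using MonoidAlgebra.induction_linear with
  | zero => exact ⟨0, by rintro _ ⟨ρ, rfl⟩; simp⟩
  | add φ ψ h1 h2 =>
    obtain ⟨C, hC⟩ := h1
    obtain ⟨D, hD⟩ := h2
    refine ⟨C + D, ?_⟩
    rintro _ ⟨ρ, rfl⟩
    simp only [map_add]
    exact (norm_add_le _ _).trans (add_le_add (hC ⟨ρ, rfl⟩) (hD ⟨ρ, rfl⟩))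
  | single g c =>
    refine ⟨‖c‖, ?_⟩
    rintro _ ⟨ρ, rfl⟩
    simp only [groupRingHom_single, norm_smul]
    refine mul_le_of_le_one_right (norm_nonneg c) ?_
    refine ContinuousLinearMap.opNorm_le_bound _ zero_le_one fun x => ?_
    rw [one_mul]
    exact (Unitary.norm_map (ρ.rep g) x).le

end GroupAlgebra

/-- The universal norm `‖φ‖ = sup_ρ ‖ρ(φ)‖` on `ℂ[G]`, the supremum being over all unitary
representations `ρ` of `G`. -/
def fullGroupSeminorm (G : Type u) [Group G] : CStarSeminorm (MonoidAlgebra ℂ G) :=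
  CStarSeminorm.ofFamily (fun ρ : UnitaryRep G => ρ.groupRingHom) UnitaryRep.bddAbove

/-- The full group `C*`-algebra `C*(G)`. -/
abbrev FullGroupCStarAlgebra (G : Type u) [Group G] : Type u :=
  (fullGroupSeminorm G).Completion

/-! ### The maximal and minimal tensor products of unital `C*`-algebras -/

/-- A unital `*`-representation of the complex `*`-algebra `A` on a complex Hilbert space. -/
structure StarRep (A : Type u) [Ring A] [StarRing A] [Algebra ℂ A] : Type (u + 1) where
  space : Type u
  [normed : NormedAddCommGroup space]
  [innerProduct : InnerProductSpace ℂ space]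
  [complete : CompleteSpace space]
  rep : A →⋆ₐ[ℂ] (space →L[ℂ] space)

attribute [instance] StarRep.normed StarRep.innerProduct StarRep.complete

section Tensor

variable {A B : Type u} [CStarAlgebra A] [CStarAlgebra B]

theorem StarRep.norm_tmul_le (π : StarRep (A ⊗[ℂ] B)) (a : A) (b : B) :
    ‖π.rep (a ⊗ₜ[ℂ] b)‖ ≤ ‖a‖ * ‖b‖ := by
  let l : A →⋆ₐ[ℂ] (π.space →L[ℂ] π.space) :=
    { (π.rep : A ⊗[ℂ] B →ₐ[ℂ] _).comp Algebra.TensorProduct.includeLeft with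
      map_star' := fun x => by
        change π.rep (star x ⊗ₜ[ℂ] 1) = star (π.rep (x ⊗ₜ[ℂ] 1))
        rw [← map_star, TensorProduct.star_tmul, star_one] }
  let r : B →⋆ₐ[ℂ] (π.space →L[ℂ] π.space) :=
    { (π.rep : A ⊗[ℂ] B →ₐ[ℂ] _).comp Algebra.TensorProduct.includeRight with
      map_star' := fun x => by
        change π.rep (1 ⊗ₜ[ℂ] star x) = star (π.rep (1 ⊗ₜ[ℂ] x))
        rw [← map_star, TensorProduct.star_tmul, star_one] }
  have h : π.rep (a ⊗ₜ[ℂ] b) = l a * r b := by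
    change _ = π.rep (a ⊗ₜ[ℂ] 1) * π.rep (1 ⊗ₜ[ℂ] b)
    rw [← map_mul, Algebra.TensorProduct.tmul_mul_tmul, mul_one, one_mul]
  rw [h]
  exact (norm_mul_le _ _).trans (mul_le_mul (NonUnitalStarAlgHom.norm_apply_le l a)
    (NonUnitalStarAlgHom.norm_apply_le r b) (norm_nonneg _) (norm_nonneg _))

theorem StarRep.bddAbove (t : A ⊗[ℂ] B) :
    BddAbove (Set.range fun π : StarRep (A ⊗[ℂ] B) => ‖π.rep t‖) := by
  induction t using TensorProduct.induction_on with
  | zero => exact ⟨0, by rintro _ ⟨ρ, rfl⟩; simp⟩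
  | add s t h1 h2 =>
    obtain ⟨C, hC⟩ := h1
    obtain ⟨D, hD⟩ := h2
    refine ⟨C + D, ?_⟩
    rintro _ ⟨ρ, rfl⟩
    simp only [map_add]
    exact (norm_add_le _ _).trans (add_le_add (hC ⟨ρ, rfl⟩) (hD ⟨ρ, rfl⟩))
  | tmul a b =>
    refine ⟨‖a‖ * ‖b‖, ?_⟩
    rintro _ ⟨π, rfl⟩
    exact π.norm_tmul_le a b

/-- The Hilbert space tensor product. -/
abbrev HilbertTensor (H K : Type u) [NormedAddCommGroup H] [InnerProductSpace ℂ H]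
    [NormedAddCommGroup K] [InnerProductSpace ℂ K] : Type u :=
  UniformSpace.Completion (H ⊗[ℂ] K)

section Operators

variable {H K : Type u} [NormedAddCommGroup H] [InnerProductSpace ℂ H] [CompleteSpace H]
  [NormedAddCommGroup K] [InnerProductSpace ℂ K] [CompleteSpace K]

set_option linter.unusedSectionVars false

/-- The bounded operator `S ⊗ T` on the Hilbert space tensor product `H ⊗ K`, which maps
`x ⊗ y` to `S x ⊗ T y`. -/
def opTensor (S : H →L[ℂ] H) (T : K →L[ℂ] K) : HilbertTensor H K →L[ℂ] HilbertTensor H K :=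
  (TensorProduct.mapL S T).completion

theorem opTensor_coe (S : H →L[ℂ] H) (T : K →L[ℂ] K) (z : H ⊗[ℂ] K) :
    opTensor S T (z : HilbertTensor H K) = (TensorProduct.mapL S T z : H ⊗[ℂ] K) := by
  simp [opTensor]

theorem opTensor_ext {P Q : HilbertTensor H K →L[ℂ] HilbertTensor H K}
    (h : ∀ z : H ⊗[ℂ] K, P (z : HilbertTensor H K) = Q (z : HilbertTensor H K)) : P = Q := by
  ext z
  induction z using UniformSpace.Completion.induction_on with
  | hp => exact isClosed_eq P.continuous Q.continuous
  | ih z => exact h z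

theorem opTensor_one : opTensor (1 : H →L[ℂ] H) (1 : K →L[ℂ] K) = 1 :=
  opTensor_ext fun z => by
    rw [opTensor_coe]
    congr 1
    exact congrArg (fun P : H ⊗[ℂ] K →L[ℂ] H ⊗[ℂ] K => P z) TensorProduct.mapL_id_id

theorem opTensor_mul (S S' : H →L[ℂ] H) (T T' : K →L[ℂ] K) :
    opTensor (S * S') (T * T') = opTensor S T * opTensor S' T' :=
  opTensor_ext fun z => by
    rw [mul_apply_eq_comp, opTensor_coe, opTensor_coe, opTensor_coe,
      TensorProduct.mapL_mul, mul_apply_eq_comp]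

theorem opTensor_add_left (S S' : H →L[ℂ] H) (T : K →L[ℂ] K) :
    opTensor (S + S') T = opTensor S T + opTensor S' T :=
  opTensor_ext fun z => by
    rw [add_apply, opTensor_coe, opTensor_coe, opTensor_coe,
      TensorProduct.mapL_add_left, add_apply, UniformSpace.Completion.coe_add]

theorem opTensor_add_right (S : H →L[ℂ] H) (T T' : K →L[ℂ] K) :
    opTensor S (T + T') = opTensor S T + opTensor S T' :=
  opTensor_ext fun z => by
    rw [add_apply, opTensor_coe, opTensor_coe, opTensor_coe,
      TensorProduct.mapL_add_right, add_apply, UniformSpace.Completion.coe_add]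

theorem opTensor_smul_left (c : ℂ) (S : H →L[ℂ] H) (T : K →L[ℂ] K) :
    opTensor (c • S) T = c • opTensor S T :=
  opTensor_ext fun z => by
    rw [smul_apply, opTensor_coe, opTensor_coe,
      TensorProduct.mapL_smul_left, smul_apply,
      UniformSpace.Completion.coe_smul]

theorem opTensor_smul_right (c : ℂ) (S : H →L[ℂ] H) (T : K →L[ℂ] K) :
    opTensor S (c • T) = c • opTensor S T :=
  opTensor_ext fun z => by
    rw [smul_apply, opTensor_coe, opTensor_coe,
      TensorProduct.mapL_smul_right, smul_apply,
      UniformSpace.Completion.coe_smul]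

theorem inner_mapL_adjoint (S : H →L[ℂ] H) (T : K →L[ℂ] K) (z w : H ⊗[ℂ] K) :
    inner ℂ (TensorProduct.mapL (star S) (star T) z) w = inner ℂ z (TensorProduct.mapL S T w) := by
  induction z using TensorProduct.induction_on with
  | zero => simp only [map_zero, inner_zero_left]
  | add z z' h1 h2 => rw [map_add, inner_add_left, inner_add_left, h1, h2]
  | tmul x y =>
    induction w using TensorProduct.induction_on with
    | zero => simp only [map_zero, inner_zero_right]
    | add w w' h1 h2 => rw [map_add, inner_add_right, inner_add_right, h1, h2]
    | tmul x' y' =>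
      rw [TensorProduct.mapL_tmul, TensorProduct.mapL_tmul, TensorProduct.inner_tmul,
        TensorProduct.inner_tmul, ContinuousLinearMap.star_eq_adjoint,
        ContinuousLinearMap.star_eq_adjoint, ContinuousLinearMap.adjoint_inner_left,
        ContinuousLinearMap.adjoint_inner_left]

theorem opTensor_star (S : H →L[ℂ] H) (T : K →L[ℂ] K) :
    opTensor (star S) (star T) = star (opTensor S T) := by
  refine (ContinuousLinearMap.eq_adjoint_iff _ _).mpr fun z w => ?_
  induction z, w using UniformSpace.Completion.induction_on₂ with
  | hp => apply isClosed_eq <;> fun_prop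
  | ih z w =>
    rw [opTensor_coe, opTensor_coe, UniformSpace.Completion.inner_coe,
      UniformSpace.Completion.inner_coe, inner_mapL_adjoint]

/-- The linear map `a ⊗ b ↦ π(a) ⊗ σ(b)`. -/
def tensorLinear (π : A →⋆ₐ[ℂ] (H →L[ℂ] H)) (σ : B →⋆ₐ[ℂ] (K →L[ℂ] K)) :
    A ⊗[ℂ] B →ₗ[ℂ] (HilbertTensor H K →L[ℂ] HilbertTensor H K) :=
  TensorProduct.lift (LinearMap.mk₂ ℂ (fun a b => opTensor (π a) (σ b))
    (fun a a' b => by rw [map_add, opTensor_add_left])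
    (fun c a b => by rw [map_smul, opTensor_smul_left])
    (fun a b b' => by rw [map_add, opTensor_add_right])
    (fun c a b => by rw [map_smul, opTensor_smul_right]))

theorem tensorLinear_tmul (π : A →⋆ₐ[ℂ] (H →L[ℂ] H)) (σ : B →⋆ₐ[ℂ] (K →L[ℂ] K)) (a : A) (b : B) :
    tensorLinear π σ (a ⊗ₜ[ℂ] b) = opTensor (π a) (σ b) := rfl

theorem tensorLinear_star (π : A →⋆ₐ[ℂ] (H →L[ℂ] H)) (σ : B →⋆ₐ[ℂ] (K →L[ℂ] K)) (t : A ⊗[ℂ] B) :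
    tensorLinear π σ (star t) = star (tensorLinear π σ t) := by
  induction t using TensorProduct.induction_on with
  | zero =>
    rw [star_zero, map_zero, ContinuousLinearMap.star_eq_adjoint, map_zero]
  | add s t h1 h2 =>
    rw [star_add, map_add, map_add, h1, h2]
    simp only [ContinuousLinearMap.star_eq_adjoint, map_add]
  | tmul a b =>
    rw [TensorProduct.star_tmul, tensorLinear_tmul, tensorLinear_tmul, map_star, map_star,
      opTensor_star]

/-- The `*`-homomorphism `π ⊗ σ`, `a ⊗ b ↦ π(a) ⊗ σ(b)`, on the Hilbert space tensor product. -/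
def tensorStarHom (π : A →⋆ₐ[ℂ] (H →L[ℂ] H)) (σ : B →⋆ₐ[ℂ] (K →L[ℂ] K)) :
    A ⊗[ℂ] B →⋆ₐ[ℂ] (HilbertTensor H K →L[ℂ] HilbertTensor H K) where
  toAlgHom := Algebra.TensorProduct.algHomOfLinearMapTensorProduct (tensorLinear π σ)
    (fun a a' b b' => by
      rw [tensorLinear_tmul, tensorLinear_tmul, tensorLinear_tmul, map_mul, map_mul, opTensor_mul])
    (by rw [tensorLinear_tmul, map_one, map_one, opTensor_one])
  map_star' t := tensorLinear_star π σ t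

theorem tensorStarHom_tmul (π : A →⋆ₐ[ℂ] (H →L[ℂ] H)) (σ : B →⋆ₐ[ℂ] (K →L[ℂ] K)) (a : A) (b : B) :
    tensorStarHom π σ (a ⊗ₜ[ℂ] b) = opTensor (π a) (σ b) := rfl

end Operators

/-- The product representation `π ⊗ σ` of `A ⊗ B`. -/
def StarRep.tensor (π : StarRep A) (σ : StarRep B) : StarRep (A ⊗[ℂ] B) where
  space := HilbertTensor π.space σ.space
  rep := tensorStarHom π.rep σ.rep

theorem StarRep.tensor_bddAbove (t : A ⊗[ℂ] B) :
    BddAbove (Set.range fun q : StarRep A × StarRep B => ‖(q.1.tensor q.2).rep t‖) := by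
  obtain ⟨C, hC⟩ := StarRep.bddAbove t
  exact ⟨C, by rintro _ ⟨q, rfl⟩; exact hC ⟨q.1.tensor q.2, rfl⟩⟩

end Tensor

section TensorNorms

variable (A B : Type u) [CStarAlgebra A] [CStarAlgebra B]

/-- The maximal `C*`-norm on the algebraic tensor product: the supremum of `‖π(t)‖` over all
`*`-representations `π` of `A ⊗ B`. -/
def maxSeminorm : CStarSeminorm (A ⊗[ℂ] B) :=
  CStarSeminorm.ofFamily (fun π : StarRep (A ⊗[ℂ] B) => π.rep) StarRep.bddAbove

/-- The minimal (spatial) `C*`-norm on the algebraic tensor product: the supremum of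
`‖(π ⊗ σ)(t)‖` over all `*`-representations `π` of `A` and `σ` of `B`. -/
def minSeminorm : CStarSeminorm (A ⊗[ℂ] B) :=
  CStarSeminorm.ofFamily (fun q : StarRep A × StarRep B => (q.1.tensor q.2).rep)
    StarRep.tensor_bddAbove

/-- The maximal tensor product. -/
abbrev MaxTensorProduct : Type u := (maxSeminorm A B).Completion

/-- The minimal tensor product. -/
abbrev MinTensorProduct : Type u := (minSeminorm A B).Completion

/-- `A ⊗_max B = A ⊗_min B`: the identity of the algebraic tensor product `A ⊗ B` extends to a
`*`-isomorphism of the maximal onto the minimal tensor product. -/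
def MaxTensorEqMinTensor : Prop :=
  ∃ e : MaxTensorProduct A B ≃⋆ₐ[ℂ] MinTensorProduct A B,
    ∀ t : A ⊗[ℂ] B, e ((maxSeminorm A B).toCompletion t) = (minSeminorm A B).toCompletion t

end TensorNorms

/-! ### Half finite representations and the two conjectures -/

/-- The free group on two generators. -/
abbrev F₂ : Type := FreeGroup (Fin 2)

/-- A linear representation `ζ : F₂ × F₂ → GL(X)` is half finite if there are a finite quotient
`Γ = F₂ ⧸ N` and a representation `ζ'` of `Γ × F₂` on `X` such that `ζ` is `ζ'` precomposed with
`Π × id`, where `Π : F₂ → Γ` is the quotient map. -/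
def IsHalfFinite {X : Type u} [NormedAddCommGroup X] [InnerProductSpace ℂ X]
    (ζ : F₂ × F₂ →* (X →L[ℂ] X)ˣ) : Prop :=
  ∃ (N : Subgroup F₂) (_ : N.Normal) (_ : Finite (F₂ ⧸ N))
    (ζ' : (F₂ ⧸ N) × F₂ →* (X →L[ℂ] X)ˣ),
    ζ = ζ'.comp ((QuotientGroup.mk' N).prodMap (MonoidHom.id F₂))

/-- The half finite approximation conjecture. Hilbert spaces are complex and separable. -/
def HalfFiniteApproximationConjecture : Prop :=
  ∀ (X : Type) [NormedAddCommGroup X] [InnerProductSpace ℂ X] [CompleteSpace X]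
    [TopologicalSpace.SeparableSpace X] (ρ : F₂ × F₂ →* unitary (X →L[ℂ] X)) (x : X), ‖x‖ = 1 →
  ∀ (E F : Finset F₂) (ε : ℝ), 0 < ε →
  ∃ (Y : Type) (_ : NormedAddCommGroup Y) (_ : InnerProductSpace ℂ Y) (_ : CompleteSpace Y)
    (_ : TopologicalSpace.SeparableSpace Y) (ζ : F₂ × F₂ →* unitary (Y →L[ℂ] Y)) (y : Y),
    IsHalfFinite (Unitary.toUnits.comp ζ) ∧ ‖y‖ = 1 ∧
    ∀ g ∈ E, ∀ g' ∈ F,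
      ‖inner ℂ x ((ρ (g, g') : X →L[ℂ] X) x) - inner ℂ y ((ζ (g, g') : Y →L[ℂ] Y) y)‖ ≤ ε

/-- Connes' embedding conjecture: `C*(F₂) ⊗_max C*(F₂) = C*(F₂) ⊗_min C*(F₂)`. -/
def ConnesEmbeddingConjecture : Prop :=
  MaxTensorEqMinTensor (FullGroupCStarAlgebra F₂) (FullGroupCStarAlgebra F₂)

end

/-! Both tensor products complete the same `*`-algebra, so it suffices that the maximal and minimal
seminorms agree. The minimal one never exceeds the maximal one, because every `π ⊗ σ` is among the
representations of the algebraic tensor product. Conversely, the elements `g ⊗ h` span a dense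
subspace for the maximal seminorm, so by `max_eq_min_of_le_span` only finite sums `s = ∑ cᵢ gᵢ ⊗ hᵢ`
matter. A representation of the tensor product yields a unitary representation `ρ` of `F₂ × F₂`, and
`‖ρ(s)x‖² = ∑ conj(cᵢ) cⱼ ⟨x, ρ(i⁻¹j)x⟩` involves only finitely many matrix coefficients. The
conjecture replaces them, up to a small error, by those of a half finite `ζ`.

What remains is that half finite representations are dominated by the minimal seminorm
(`norm_sum_le_min_of_isHalfFinite`). Write `ζ(g, h) = α(g) β(h)`, where `α` and `β` commute and `α`
factors through a finite group `Γ`. By Fell's absorption principle, `y ↦ ∑ₖ δₖ ⊗ α(k)⁻¹ y`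
intertwines `αβ` with `λ ⊗ β`, where `λ` is the left regular representation of `Γ`; it is `√|Γ|`
times an isometry, and finiteness of `Γ` makes the sum meaningful. Since `λ ⊗ β` is a tensor product
of representations of the two factors, the minimal seminorm bounds it. -/

noncomputable section

namespace CStarSeminorm

variable {R : Type u} [Ring R] [StarRing R] [Algebra ℂ R]

/-- A `*`-homomorphism on `R`, regarded as a ring homomorphism on the seminormed algebra. -/
def preHom (p : CStarSeminorm R) {B : Type v} [CStarAlgebra B] (f : R →⋆ₐ[ℂ] B) : p.Pre →+* B :=
  (f : R →+* B)

theorem continuous_preHom (p : CStarSeminorm R) {B : Type v} [CStarAlgebra B]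
    (f : R →⋆ₐ[ℂ] B) (hf : ∀ a, ‖f a‖ ≤ p.toSeminorm a) : Continuous (p.preHom f) :=
  AddMonoidHomClass.continuous_of_bound (p.preHom f) 1 fun a => by
    rw [one_mul]
    exact hf a

/-- A `*`-homomorphism dominated by a `C*`-seminorm extends to the completion. -/
def extend [StarModule ℂ R] (p : CStarSeminorm R) {B : Type v} [CStarAlgebra B]
    (f : R →⋆ₐ[ℂ] B) (hf : ∀ a, ‖f a‖ ≤ p.toSeminorm a) : p.Completion →⋆ₐ[ℂ] B where
  toRingHom := UniformSpace.Completion.extensionHom (p.preHom f) (p.continuous_preHom f hf)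
  commutes' r :=
    (UniformSpace.Completion.extensionHom_coe (p.preHom f) (p.continuous_preHom f hf)
      (algebraMap ℂ p.Pre r)).trans (f.toAlgHom.commutes r)
  map_star' x := by
    have hc : Continuous
        (UniformSpace.Completion.extensionHom (p.preHom f) (p.continuous_preHom f hf)) :=
      UniformSpace.Completion.continuous_extension
    change UniformSpace.Completion.extensionHom (p.preHom f) (p.continuous_preHom f hf) (star x) =
      star (UniformSpace.Completion.extensionHom (p.preHom f) (p.continuous_preHom f hf) x)
    induction x using UniformSpace.Completion.induction_on with
    | hp => exact isClosed_eq (hc.comp p.continuous_star_completion) (continuous_star.comp hc)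
    | ih a =>
      rw [star_coe, UniformSpace.Completion.extensionHom_coe,
        UniformSpace.Completion.extensionHom_coe]
      exact map_star f (show R from a)

theorem extend_toCompletion [StarModule ℂ R] (p : CStarSeminorm R) {B : Type v} [CStarAlgebra B]
    (f : R →⋆ₐ[ℂ] B) (hf : ∀ a, ‖f a‖ ≤ p.toSeminorm a) (a : R) :
    p.extend f hf (p.toCompletion a) = f a :=
  UniformSpace.Completion.extensionHom_coe (p.preHom f) (p.continuous_preHom f hf) a

theorem denseRange_toCompletion (p : CStarSeminorm R) : DenseRange p.toCompletion :=
  UniformSpace.Completion.denseRange_coe (α := p.Pre)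

/-- Reduces the embedding conjecture to an equality of seminorms: once `p` and `q` are identified,
the identity map serves. -/
theorem exists_starAlgEquiv_of_eq [StarModule ℂ R] {p q : CStarSeminorm R} (h : p = q) :
    ∃ e : p.Completion ≃⋆ₐ[ℂ] q.Completion, ∀ t, e (p.toCompletion t) = q.toCompletion t := by
  subst h
  exact ⟨StarAlgEquiv.refl ℂ _, fun _ => rfl⟩

end CStarSeminorm

/-! ### Group elements in the full group `C*`-algebra -/

section GroupElements

variable {G H : Type u} [Group G] [Group H]

/-- The canonical unitary of the full group `C*`-algebra given by a group element. -/
def FullGroupCStarAlgebra.of (g : G) : FullGroupCStarAlgebra G :=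
  (fullGroupSeminorm G).toCompletion (MonoidAlgebra.single g 1)

theorem FullGroupCStarAlgebra.of_one : of (1 : G) = 1 :=
  map_one (fullGroupSeminorm G).toCompletion

theorem FullGroupCStarAlgebra.of_mul (g h : G) : of (g * h) = of g * of h := by
  simp only [of]
  rw [← map_mul, MonoidAlgebra.single_mul_single, one_mul]

theorem FullGroupCStarAlgebra.star_of (g : G) : star (of g) = of g⁻¹ := by
  simp only [of]
  rw [← map_star, groupRing_star_single, star_one]

/-- A closed subspace of the full group `C*`-algebra which contains all group elements is the
whole algebra. -/
theorem FullGroupCStarAlgebra.mem_of_isClosed (S : Submodule ℂ (FullGroupCStarAlgebra G))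
    (hS : IsClosed (S : Set (FullGroupCStarAlgebra G))) (h : ∀ g, of g ∈ S)
    (a : FullGroupCStarAlgebra G) : a ∈ S := by
  induction a using (fullGroupSeminorm G).denseRange_toCompletion.induction_on with
  | hp => exact hS
  | ih φ =>
    induction φ using MonoidAlgebra.induction_linear with
    | zero => rw [map_zero]; exact S.zero_mem
    | add φ ψ h1 h2 => rw [map_add]; exact S.add_mem h1 h2
    | single g c =>
      have : (MonoidAlgebra.single g c : MonoidAlgebra ℂ G) = c • MonoidAlgebra.single g 1 := by
        rw [MonoidAlgebra.smul_single, smul_eq_mul, mul_one]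
      rw [this, map_smul]
      exact S.smul_mem c (h g)

theorem UnitaryRep.norm_groupRingHom_le (ρ : UnitaryRep G) (φ : MonoidAlgebra ℂ G) :
    ‖ρ.groupRingHom φ‖ ≤ (fullGroupSeminorm G).toSeminorm φ :=
  le_ciSup (UnitaryRep.bddAbove φ) ρ

/-- The representation of the full group `C*`-algebra given by a unitary representation. -/
def UnitaryRep.toStarRep (ρ : UnitaryRep G) : StarRep (FullGroupCStarAlgebra G) where
  space := ρ.space
  rep := (fullGroupSeminorm G).extend ρ.groupRingHom ρ.norm_groupRingHom_le

theorem UnitaryRep.toStarRep_of (ρ : UnitaryRep G) (g : G) :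
    ρ.toStarRep.rep (FullGroupCStarAlgebra.of g) = (ρ.rep g : ρ.space →L[ℂ] ρ.space) :=
  ((fullGroupSeminorm G).extend_toCompletion ρ.groupRingHom ρ.norm_groupRingHom_le
    (MonoidAlgebra.single g 1)).trans ((ρ.groupRingHom_single g 1).trans (one_smul _ _))

/-- The element `g ⊗ h` of the algebraic tensor product. -/
def ofTensor (g : G × H) : FullGroupCStarAlgebra G ⊗[ℂ] FullGroupCStarAlgebra H :=
  FullGroupCStarAlgebra.of g.1 ⊗ₜ[ℂ] FullGroupCStarAlgebra.of g.2

theorem ofTensor_one : ofTensor (1 : G × H) = 1 := by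
  simp only [ofTensor, Prod.fst_one, Prod.snd_one, FullGroupCStarAlgebra.of_one]
  rfl

theorem ofTensor_mul (g h : G × H) : ofTensor (g * h) = ofTensor g * ofTensor h := by
  simp only [ofTensor, Prod.fst_mul, Prod.snd_mul, FullGroupCStarAlgebra.of_mul]
  rw [Algebra.TensorProduct.tmul_mul_tmul]

theorem star_ofTensor (g : G × H) : star (ofTensor g) = ofTensor g⁻¹ := by
  simp only [ofTensor, TensorProduct.star_tmul, FullGroupCStarAlgebra.star_of, Prod.fst_inv,
    Prod.snd_inv]

/-- The unitary `g ⊗ h` of the algebraic tensor product. -/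
def ofTensorUnitary :
    G × H →* unitary (FullGroupCStarAlgebra G ⊗[ℂ] FullGroupCStarAlgebra H) where
  toFun g := ⟨ofTensor g, by
    rw [Unitary.mem_iff, star_ofTensor, ← ofTensor_mul, ← ofTensor_mul, inv_mul_cancel,
      mul_inv_cancel, ofTensor_one]
    exact ⟨rfl, rfl⟩⟩
  map_one' := Subtype.ext ofTensor_one
  map_mul' g h := Subtype.ext (ofTensor_mul g h)

/-- The unitary representation of `G × H` given by a representation of `C*(G) ⊗ C*(H)`. -/
def StarRep.groupRep (π : StarRep (FullGroupCStarAlgebra G ⊗[ℂ] FullGroupCStarAlgebra H)) :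
    G × H →* unitary (π.space →L[ℂ] π.space) :=
  (Unitary.map { π.rep with }).toMonoidHom.comp ofTensorUnitary

theorem StarRep.groupRep_coe
    (π : StarRep (FullGroupCStarAlgebra G ⊗[ℂ] FullGroupCStarAlgebra H)) (g : G × H) :
    (π.groupRep g : π.space →L[ℂ] π.space) = π.rep (ofTensor g) := rfl

end GroupElements

section Norms

theorem minSeminorm_le_maxSeminorm {A B : Type u} [CStarAlgebra A] [CStarAlgebra B] (t : A ⊗[ℂ] B) :
    (minSeminorm A B).toSeminorm t ≤ (maxSeminorm A B).toSeminorm t :=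
  Real.iSup_le (fun q => le_ciSup (f := fun π : StarRep (A ⊗[ℂ] B) => ‖π.rep t‖)
    (StarRep.bddAbove t) (q.1.tensor q.2)) (Real.iSup_nonneg fun _ => norm_nonneg _)

/-- This bound makes `(a, b) ↦ a ⊗ b` a bounded bilinear map into the maximal tensor product, which
the density argument needs. -/
theorem max_tmul_le {A B : Type u} [CStarAlgebra A] [CStarAlgebra B] (a : A) (b : B) :
    (maxSeminorm A B).toSeminorm (a ⊗ₜ[ℂ] b) ≤ ‖a‖ * ‖b‖ :=
  Real.iSup_le (fun π => π.norm_tmul_le a b) (by positivity)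

theorem tensor_le_min {A B : Type u} [CStarAlgebra A] [CStarAlgebra B] (π : StarRep A)
    (σ : StarRep B) (t : A ⊗[ℂ] B) :
    ‖(π.tensor σ).rep t‖ ≤ (minSeminorm A B).toSeminorm t :=
  le_ciSup (f := fun q : StarRep A × StarRep B => ‖(q.1.tensor q.2).rep t‖)
    (StarRep.tensor_bddAbove t) (π, σ)

theorem CStarSeminorm.ext_le {R : Type u} [Ring R] [StarRing R] [Algebra ℂ R]
    {p q : CStarSeminorm R} (h1 : ∀ t, p.toSeminorm t ≤ q.toSeminorm t)
    (h2 : ∀ t, q.toSeminorm t ≤ p.toSeminorm t) : p = q := by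
  have : p.toSeminorm = q.toSeminorm := Seminorm.ext fun t => le_antisymm (h1 t) (h2 t)
  cases p; cases q; congr

variable {G H : Type u} [Group G] [Group H]

/-- The span of the elements `g ⊗ h` is dense in the maximal tensor product. -/
theorem toCompletion_mem_closure_span
    (t : FullGroupCStarAlgebra G ⊗[ℂ] FullGroupCStarAlgebra H) :
    (maxSeminorm _ _).toCompletion t ∈ ((Submodule.span ℂ (Set.range
      (ofTensor : G × H → _))).map
        (maxSeminorm (FullGroupCStarAlgebra G)
          (FullGroupCStarAlgebra H)).toCompletion.toAlgHom.toLinearMap).topologicalClosure := by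
  set Φ := (maxSeminorm (FullGroupCStarAlgebra G) (FullGroupCStarAlgebra H)).toCompletion with hΦ
  set M := ((Submodule.span ℂ (Set.range (ofTensor : G × H → _))).map
    Φ.toAlgHom.toLinearMap).topologicalClosure with hM
  have hcl : IsClosed (M : Set (MaxTensorProduct (FullGroupCStarAlgebra G)
    (FullGroupCStarAlgebra H))) := Submodule.isClosed_topologicalClosure _
  -- Since `L` is continuous in each variable, membership in the closed subspace `M` passes from
  -- group elements to all of `C*(H)` with the left factor a group element (`h1`), and then to all
  -- of `C*(G)` with the right factor arbitrary (`h2`).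
  let L : FullGroupCStarAlgebra G →L[ℂ] FullGroupCStarAlgebra H →L[ℂ]
      MaxTensorProduct (FullGroupCStarAlgebra G) (FullGroupCStarAlgebra H) :=
    LinearMap.mkContinuous₂ ((TensorProduct.mk ℂ _ _).compr₂ Φ.toAlgHom.toLinearMap) 1 fun a b => by
      rw [one_mul]
      exact (CStarSeminorm.norm_toCompletion _ _).trans_le (max_tmul_le a b)
  have hL : ∀ a b, L a b = Φ (a ⊗ₜ[ℂ] b) := fun a b => rfl
  have h1 : ∀ (g : G) (b : FullGroupCStarAlgebra H), L (FullGroupCStarAlgebra.of g) b ∈ M :=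
    fun g b => FullGroupCStarAlgebra.mem_of_isClosed
      (M.comap (L (FullGroupCStarAlgebra.of g)).toLinearMap)
      (hcl.preimage (L (FullGroupCStarAlgebra.of g)).continuous)
      (fun h => Submodule.le_topologicalClosure _
        (Submodule.mem_map_of_mem (Submodule.subset_span ⟨(g, h), rfl⟩))) b
  have h2 : ∀ (a : FullGroupCStarAlgebra G) (b : FullGroupCStarAlgebra H), L a b ∈ M :=
    fun a b => FullGroupCStarAlgebra.mem_of_isClosed
      (M.comap (L.flip b).toLinearMap) (hcl.preimage (L.flip b).continuous) (fun g => h1 g b) a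
  induction t using TensorProduct.induction_on with
  | zero => rw [map_zero]; exact M.zero_mem
  | add s t hs ht => rw [map_add]; exact M.add_mem hs ht
  | tmul a b => exact h2 a b

/-- It suffices to compare the maximal and the minimal norm on the algebraic tensor product of the
group rings. -/
theorem max_eq_min_of_le_span
    (h : ∀ s ∈ Submodule.span ℂ (Set.range (ofTensor : G × H → _)),
      (maxSeminorm (FullGroupCStarAlgebra G) (FullGroupCStarAlgebra H)).toSeminorm s ≤
        (minSeminorm (FullGroupCStarAlgebra G) (FullGroupCStarAlgebra H)).toSeminorm s) :
    maxSeminorm (FullGroupCStarAlgebra G) (FullGroupCStarAlgebra H) =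
      minSeminorm (FullGroupCStarAlgebra G) (FullGroupCStarAlgebra H) := by
  refine CStarSeminorm.ext_le (fun t => ?_) minSeminorm_le_maxSeminorm
  refine le_of_forall_pos_le_add fun ε hε => ?_
  obtain ⟨_, ⟨s, hs, rfl⟩, hd⟩ := Metric.mem_closure_iff.mp
    (toCompletion_mem_closure_span (G := G) (H := H) t) (ε / 2) (half_pos hε)
  set p := maxSeminorm (FullGroupCStarAlgebra G) (FullGroupCStarAlgebra H)
  set q := minSeminorm (FullGroupCStarAlgebra G) (FullGroupCStarAlgebra H)
  have hd' : p.toSeminorm (t - s) < ε / 2 := by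
    rw [← p.norm_toCompletion, map_sub, ← dist_eq_norm]
    exact hd
  have e1 : p.toSeminorm t ≤ p.toSeminorm (t - s) + p.toSeminorm s := by
    simpa using map_add_le_add p.toSeminorm (t - s) s
  have e2 : q.toSeminorm s ≤ q.toSeminorm (t - s) + q.toSeminorm t := by
    have := map_sub_le_add q.toSeminorm t (t - s)
    rw [sub_sub_cancel] at this
    linarith
  -- The same approximant `s` serves both seminorms: passing from `t` to `s` in `p` and back in `q`
  -- costs at most `ε / 2` each.
  have e3 : q.toSeminorm (t - s) ≤ p.toSeminorm (t - s) := minSeminorm_le_maxSeminorm _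
  have e4 := h s hs
  linarith

end Norms

/-! ### Half finite representations -/

section HalfFinite

variable {G H : Type u} [Group G] [Group H]

theorem UnitaryRep.tensor_toStarRep_ofTensor (ρ : UnitaryRep G) (σ : UnitaryRep H) (g : G × H) :
    tensorStarHom ρ.toStarRep.rep σ.toStarRep.rep (ofTensor g) =
      opTensor (ρ.rep g.1 : ρ.space →L[ℂ] ρ.space) (σ.rep g.2 : σ.space →L[ℂ] σ.space) := by
  refine (tensorStarHom_tmul _ _ _ _).trans ?_
  rw [UnitaryRep.toStarRep_of, UnitaryRep.toStarRep_of]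
  rfl

/-- The sum on the left is `(ρ ⊗ σ)(∑ cᵢ gᵢ ⊗ hᵢ)` applied to `z`. Vectors of the algebraic tensor
product suffice, because `fellMap` takes its values there. -/
theorem UnitaryRep.norm_sum_mapL_le_min (ρ : UnitaryRep G) (σ : UnitaryRep H)
    (T : Finset (G × H)) (c : G × H → ℂ) (z : ρ.space ⊗[ℂ] σ.space) :
    ‖∑ i ∈ T, c i • TensorProduct.mapL (ρ.rep i.1 : ρ.space →L[ℂ] ρ.space)
        (σ.rep i.2 : σ.space →L[ℂ] σ.space) z‖ ≤
      (minSeminorm (FullGroupCStarAlgebra G) (FullGroupCStarAlgebra H)).toSeminorm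
        (∑ i ∈ T, c i • ofTensor i) * ‖z‖ := by
  let Φ : FullGroupCStarAlgebra G ⊗[ℂ] FullGroupCStarAlgebra H →⋆ₐ[ℂ]
      (HilbertTensor ρ.space σ.space →L[ℂ] HilbertTensor ρ.space σ.space) :=
    tensorStarHom ρ.toStarRep.rep σ.toStarRep.rep
  have key : Φ (∑ i ∈ T, c i • ofTensor i) (z : HilbertTensor ρ.space σ.space) =
      ((∑ i ∈ T, c i • TensorProduct.mapL (ρ.rep i.1 : ρ.space →L[ℂ] ρ.space)
        (σ.rep i.2 : σ.space →L[ℂ] σ.space) z : ρ.space ⊗[ℂ] σ.space) :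
          HilbertTensor ρ.space σ.space) := by
    -- The embedding into the completion is linear, so the coercion passes through the sum.
    have hcoe := map_sum (UniformSpace.Completion.toComplₗᵢ (𝕜 := ℂ) (E := ρ.space ⊗[ℂ] σ.space))
      (fun i => c i • TensorProduct.mapL (ρ.rep i.1 : ρ.space →L[ℂ] ρ.space)
        (σ.rep i.2 : σ.space →L[ℂ] σ.space) z) T
    simp only [UniformSpace.Completion.coe_toComplₗᵢ, UniformSpace.Completion.coe_smul] at hcoe
    rw [hcoe, map_sum, sum_apply]
    refine Finset.sum_congr rfl fun i _ => ?_
    rw [map_smul, smul_apply]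
    have h1 : Φ (ofTensor i) = _ := ρ.tensor_toStarRep_ofTensor σ i
    rw [h1, opTensor_coe]
  have hn := (Φ (∑ i ∈ T, c i • ofTensor i)).le_opNorm (z : HilbertTensor ρ.space σ.space)
  rw [key, UniformSpace.Completion.norm_coe, UniformSpace.Completion.norm_coe] at hn
  exact hn.trans (mul_le_mul_of_nonneg_right (tensor_le_min ρ.toStarRep σ.toStarRep _)
    (norm_nonneg _))

/-- The permutation representation of `G` on `ℓ²(G ⧸ N)`. -/
def quotientRep (N : Subgroup G) [Fintype (G ⧸ N)] :
    G →* unitary (EuclideanSpace ℂ (G ⧸ N) →L[ℂ] EuclideanSpace ℂ (G ⧸ N)) where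
  toFun g := Unitary.linearIsometryEquiv.symm
    (LinearIsometryEquiv.piLpCongrLeft 2 ℂ ℂ (MulAction.toPerm g))
  map_one' := by
    rw [← map_one Unitary.linearIsometryEquiv.symm]
    congr 1
    ext x k
    simp [LinearIsometryEquiv.piLpCongrLeft_apply, Equiv.piCongrLeft']
  map_mul' g h := by
    rw [← map_mul Unitary.linearIsometryEquiv.symm]
    congr 1
    ext x k
    simp [LinearIsometryEquiv.piLpCongrLeft_apply, Equiv.piCongrLeft', mul_smul]

theorem quotientRep_single (N : Subgroup G) [Fintype (G ⧸ N)] [DecidableEq (G ⧸ N)] (g : G)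
    (k : G ⧸ N) :
    (quotientRep N g : EuclideanSpace ℂ (G ⧸ N) →L[ℂ] EuclideanSpace ℂ (G ⧸ N))
      (EuclideanSpace.single k 1) = EuclideanSpace.single (g • k) 1 :=
  LinearIsometryEquiv.piLpCongrLeft_single (MulAction.toPerm g) k (1 : ℂ)

variable {Γ : Type u} [Group Γ] [Fintype Γ] [DecidableEq Γ]
  {Y : Type u} [NormedAddCommGroup Y] [InnerProductSpace ℂ Y]

/-- The map `y ↦ ∑ₖ δₖ ⊗ α(k)⁻¹ y` to `ℓ²(Γ) ⊗ Y`. -/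
def fellMap (α : Γ →* (Y →L[ℂ] Y)) : Y →ₗ[ℂ] EuclideanSpace ℂ Γ ⊗[ℂ] Y :=
  ∑ k : Γ, (TensorProduct.mk ℂ (EuclideanSpace ℂ Γ) Y (EuclideanSpace.single k 1)).comp
    (α k⁻¹).toLinearMap

theorem fellMap_apply (α : Γ →* (Y →L[ℂ] Y)) (y : Y) :
    fellMap α y = ∑ k : Γ, (EuclideanSpace.single k (1 : ℂ)) ⊗ₜ[ℂ] α k⁻¹ y := by
  simp [fellMap]

/-- The `δₖ` are orthonormal and each `α(k⁻¹)` preserves norms, so each of the `|Γ|` orthogonal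
summands contributes `‖y‖²`. -/
theorem norm_fellMap (α : Γ →* (Y →L[ℂ] Y)) (hα : ∀ k y, ‖α k y‖ = ‖y‖) (y : Y) :
    ‖fellMap α y‖ = √(Fintype.card Γ) * ‖y‖ := by
  have h : ‖fellMap α y‖ ^ 2 = Fintype.card Γ * ‖y‖ ^ 2 := by
    rw [← inner_self_eq_norm_sq (𝕜 := ℂ), fellMap_apply, sum_inner]
    simp only [inner_sum, TensorProduct.inner_tmul, EuclideanSpace.inner_single_left,
      PiLp.single_apply]
    simp only [map_one, one_mul, ite_mul, zero_mul, Finset.sum_ite_eq, Finset.mem_univ, if_true,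
      map_sum, inner_self_eq_norm_sq, hα, Finset.sum_const, Finset.card_univ, nsmul_eq_mul]
  rw [← Real.sqrt_sq (norm_nonneg (fellMap α y)), h, Real.sqrt_mul (Nat.cast_nonneg _),
    Real.sqrt_sq (norm_nonneg y)]

/-- Fell's absorption principle: `fellMap` intertwines `α β` and `λ ⊗ β`. -/
theorem mapL_fellMap (α : Γ →* (Y →L[ℂ] Y)) (k : Γ)
    (S : EuclideanSpace ℂ Γ →L[ℂ] EuclideanSpace ℂ Γ)
    (hS : ∀ l, S (EuclideanSpace.single l 1) = EuclideanSpace.single (k * l) 1) (T : Y →L[ℂ] Y)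
    (hT : ∀ l, Commute T (α l)) (y : Y) :
    TensorProduct.mapL S T (fellMap α y) = fellMap α (α k (T y)) := by
  rw [fellMap_apply, fellMap_apply, map_sum]
  -- Reindexing by `l ↦ k * l` matches the terms, since `(k * l)⁻¹ * k = l⁻¹` and `T` commutes with
  -- `α l⁻¹`.
  refine Fintype.sum_equiv (Equiv.mulLeft k) _ _ fun l => ?_
  rw [TensorProduct.mapL_tmul, hS, Equiv.coe_mulLeft]
  congr 1
  rw [← mul_apply_eq_comp, ← mul_apply_eq_comp, ← map_mul, ← mul_apply_eq_comp, (hT _).eq,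
    mul_inv_rev, inv_mul_cancel_right]

end HalfFinite

section FiniteQuotient

variable {G H : Type u} [Group G] [Group H]
  {Y : Type u} [NormedAddCommGroup Y] [InnerProductSpace ℂ Y] [CompleteSpace Y]

/-- A unitary representation of `G × H` which factors through a finite quotient of `G` is
dominated by the minimal tensor norm. -/
theorem norm_sum_le_min_of_finite_quotient (N : Subgroup G) [N.Normal] [Finite (G ⧸ N)]
    (α : G ⧸ N →* (Y →L[ℂ] Y)) (β : H →* unitary (Y →L[ℂ] Y))
    (hα : ∀ k y, ‖α k y‖ = ‖y‖) (hαβ : ∀ k h, Commute (β h : Y →L[ℂ] Y) (α k))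
    (T : Finset (G × H)) (c : G × H → ℂ) (y : Y) :
    ‖∑ i ∈ T, c i • α i.1 ((β i.2 : Y →L[ℂ] Y) y)‖ ≤
      (minSeminorm (FullGroupCStarAlgebra G) (FullGroupCStarAlgebra H)).toSeminorm
        (∑ i ∈ T, c i • ofTensor i) * ‖y‖ := by
  classical
  have := Fintype.ofFinite (G ⧸ N)
  have hn := UnitaryRep.norm_sum_mapL_le_min
    { space := EuclideanSpace ℂ (G ⧸ N), rep := quotientRep N }
    { space := Y, rep := β } T c (fellMap α y)
  have key : ∀ i : G × H, TensorProduct.mapL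
      (quotientRep N i.1 : EuclideanSpace ℂ (G ⧸ N) →L[ℂ] EuclideanSpace ℂ (G ⧸ N))
      (β i.2 : Y →L[ℂ] Y) (fellMap α y) = fellMap α (α i.1 ((β i.2 : Y →L[ℂ] Y) y)) :=
    -- The action of `i.1` on `G ⧸ N` is left multiplication by its class, as `mapL_fellMap`
    -- requires.
    fun i => mapL_fellMap α (i.1 : G ⧸ N) _ (quotientRep_single N i.1) _ (fun l => hαβ l i.2) y
  simp only [key, ← map_smul, ← map_sum, norm_fellMap α hα] at hn
  simp only [map_smul] at hn
  rw [mul_left_comm] at hn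
  have : Nonempty (G ⧸ N) := ⟨1⟩
  -- The factor `√|G ⧸ N|` from `norm_fellMap` occurs on both sides and is positive, so it cancels.
  exact le_of_mul_le_mul_left hn (Real.sqrt_pos.mpr (Nat.cast_pos.mpr Fintype.card_pos))

/-- The elements `(g, 1)` and `(1, g')` commute, so `ζ` splits into commuting representations `α`
and `β` of the two factors, with `α` defined on the finite quotient. -/
theorem norm_sum_le_min_of_isHalfFinite {Y : Type} [NormedAddCommGroup Y] [InnerProductSpace ℂ Y]
    [CompleteSpace Y] (ζ : F₂ × F₂ →* unitary (Y →L[ℂ] Y))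
    (hζ : IsHalfFinite (Unitary.toUnits.comp ζ)) (T : Finset (F₂ × F₂)) (c : F₂ × F₂ → ℂ) (y : Y) :
    ‖∑ i ∈ T, c i • (ζ i : Y →L[ℂ] Y) y‖ ≤
      (minSeminorm (FullGroupCStarAlgebra F₂) (FullGroupCStarAlgebra F₂)).toSeminorm
        (∑ i ∈ T, c i • ofTensor i) * ‖y‖ := by
  obtain ⟨N, hN, hfin, ζ', h⟩ := hζ
  have hval : ∀ g g' : F₂, (ζ (g, g') : Y →L[ℂ] Y) = ζ' ((g : F₂ ⧸ N), g') := fun g g' =>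
    congrArg Units.val (DFunLike.congr_fun h (g, g'))
  -- `ζ'` is only known to take invertible values. Isometry of `α` is recovered from the unitary `ζ
  -- (g, 1)` because every class has a representative, while `β` is taken from `ζ` itself so as to
  -- be unitary outright.
  let α : F₂ ⧸ N →* (Y →L[ℂ] Y) := (Units.coeHom _).comp (ζ'.comp (MonoidHom.inl _ _))
  let β : F₂ →* unitary (Y →L[ℂ] Y) := ζ.comp (MonoidHom.inr _ _)
  have hα : ∀ g : F₂, α (g : F₂ ⧸ N) = (ζ (g, 1) : Y →L[ℂ] Y) := fun g => (hval g 1).symm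
  have hmul : ∀ g g' : F₂, (ζ (g, g') : Y →L[ℂ] Y) = α (g : F₂ ⧸ N) * β g' := fun g g' => by
    rw [hα]
    change _ = (ζ (g, 1) : Y →L[ℂ] Y) * (ζ (1, g') : Y →L[ℂ] Y)
    rw [← Submonoid.coe_mul, ← map_mul, Prod.mk_mul_mk, mul_one, one_mul]
  have hmul' : ∀ g g' : F₂, (ζ (g, g') : Y →L[ℂ] Y) = β g' * α (g : F₂ ⧸ N) := fun g g' => by
    rw [hα]
    change _ = (ζ (1, g') : Y →L[ℂ] Y) * (ζ (g, 1) : Y →L[ℂ] Y)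
    rw [← Submonoid.coe_mul, ← map_mul, Prod.mk_mul_mk, mul_one, one_mul]
  have := norm_sum_le_min_of_finite_quotient N α β
    (fun k y => by
      obtain ⟨g, rfl⟩ := QuotientGroup.mk_surjective k
      rw [hα]
      exact Unitary.norm_map _ y)
    (fun k g' => by
      obtain ⟨g, rfl⟩ := QuotientGroup.mk_surjective k
      exact (hmul' g g').symm.trans (hmul g g'))
    T c y
  refine le_trans (le_of_eq ?_) this
  refine congrArg norm (Finset.sum_congr rfl fun i _ => ?_)
  rw [← mul_apply_eq_comp, ← hmul]

end FiniteQuotient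

/-! ### Cyclic subspaces -/

section Cyclic

variable {G : Type u} [Group G] {X : Type v} [NormedAddCommGroup X] [InnerProductSpace ℂ X]
  [CompleteSpace X]

theorem coe_unitary_inv (ρ : G →* unitary (X →L[ℂ] X)) (g : G) :
    (ρ g⁻¹ : X →L[ℂ] X) = star (ρ g : X →L[ℂ] X) := by
  rw [map_inv]
  rfl

/-- The restriction of a unitary representation to a closed invariant subspace. -/
def restrictUnitary (ρ : G →* unitary (X →L[ℂ] X)) (K : Submodule ℂ X) [CompleteSpace K]
    (hK : ∀ g, ∀ x ∈ K, (ρ g : X →L[ℂ] X) x ∈ K) : G →* unitary (K →L[ℂ] K) :=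
  let R : G →* (K →L[ℂ] K) :=
    { toFun g := (ρ g : X →L[ℂ] X).restrict (hK g)
      map_one' := by ext; simp
      map_mul' g h := by ext; simp }
  have hR : ∀ g, star (R g) = R g⁻¹ := fun g => by
    symm
    refine (ContinuousLinearMap.eq_adjoint_iff _ _).mpr fun z w => ?_
    change inner ℂ ((ρ g⁻¹ : X →L[ℂ] X) z) (w : X) = inner ℂ (z : X) ((ρ g : X →L[ℂ] X) w)
    rw [coe_unitary_inv, ContinuousLinearMap.star_eq_adjoint,
      ContinuousLinearMap.adjoint_inner_left]
  R.codRestrict (unitary (K →L[ℂ] K)) fun g => by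
    rw [Unitary.mem_iff, hR, ← map_mul, ← map_mul, inv_mul_cancel, mul_inv_cancel, map_one]
    exact ⟨rfl, rfl⟩

/-- The closed linear span of the orbit of a vector. -/
def cyclicSubspace (ρ : G →* unitary (X →L[ℂ] X)) (x : X) : Submodule ℂ X :=
  (Submodule.span ℂ (Set.range fun g => (ρ g : X →L[ℂ] X) x)).topologicalClosure

theorem mem_cyclicSubspace (ρ : G →* unitary (X →L[ℂ] X)) (x : X) : x ∈ cyclicSubspace ρ x :=
  Submodule.le_topologicalClosure _ (Submodule.subset_span ⟨1, by simp⟩)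

instance (ρ : G →* unitary (X →L[ℂ] X)) (x : X) : CompleteSpace (cyclicSubspace ρ x) :=
  (Submodule.isClosed_topologicalClosure _).completeSpace_coe

/-- The conjecture concerns separable spaces only; a countable orbit has a separable closed span. -/
instance [Countable G] (ρ : G →* unitary (X →L[ℂ] X)) (x : X) :
    TopologicalSpace.SeparableSpace (cyclicSubspace ρ x) :=
  ((Set.countable_range _).isSeparable.span (R := ℂ)).closure.separableSpace

theorem apply_mem_cyclicSubspace (ρ : G →* unitary (X →L[ℂ] X)) (x : X) (g : G) (z : X)
    (hz : z ∈ cyclicSubspace ρ x) : (ρ g : X →L[ℂ] X) z ∈ cyclicSubspace ρ x := by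
  have : Submodule.span ℂ (Set.range fun g => (ρ g : X →L[ℂ] X) x) ≤
      (cyclicSubspace ρ x).comap (ρ g : X →L[ℂ] X).toLinearMap := by
    rw [Submodule.span_le]
    rintro _ ⟨h, rfl⟩
    refine Submodule.le_topologicalClosure _ (Submodule.subset_span ⟨g * h, ?_⟩)
    simp
  exact Submodule.topologicalClosure_minimal _ this
    ((Submodule.isClosed_topologicalClosure _).preimage (ρ g : X →L[ℂ] X).continuous) hz

/-- The norm of `∑ cᵢ ρ(i) x` in terms of the positive definite function of `x`. -/
theorem norm_sq_sum_rep (ρ : G →* unitary (X →L[ℂ] X)) (x : X) (T : Finset G) (c : G → ℂ) :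
    ((‖∑ i ∈ T, c i • (ρ i : X →L[ℂ] X) x‖ ^ 2 : ℝ) : ℂ) =
      ∑ i ∈ T, ∑ j ∈ T, star (c i) * c j * inner ℂ x ((ρ (i⁻¹ * j) : X →L[ℂ] X) x) := by
  rw [Complex.ofReal_pow]
  refine (inner_self_eq_norm_sq_to_K (𝕜 := ℂ) (∑ i ∈ T, c i • (ρ i : X →L[ℂ] X) x)).symm.trans ?_
  rw [sum_inner]
  refine Finset.sum_congr rfl fun i _ => ?_
  rw [inner_sum]
  refine Finset.sum_congr rfl fun j _ => ?_
  rw [inner_smul_left, inner_smul_right, map_mul, Submonoid.coe_mul, coe_unitary_inv,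
    mul_apply_eq_comp, ContinuousLinearMap.star_eq_adjoint, ContinuousLinearMap.adjoint_inner_right,
    mul_assoc]
  rfl

/-- By `norm_sq_sum_rep`, the two squared norms differ by a sum of coefficient differences at `i⁻¹ *
j` with weights `conj(cᵢ) cⱼ`; the triangle inequality does the rest. -/
theorem norm_sq_sum_rep_le_add {Y : Type v} [NormedAddCommGroup Y] [InnerProductSpace ℂ Y]
    [CompleteSpace Y] (ρ : G →* unitary (X →L[ℂ] X)) (ζ : G →* unitary (Y →L[ℂ] Y))
    (x : X) (y : Y) (T : Finset G) (c : G → ℂ) (ε : ℝ)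
    (h : ∀ i ∈ T, ∀ j ∈ T, ‖inner ℂ x ((ρ (i⁻¹ * j) : X →L[ℂ] X) x) -
      inner ℂ y ((ζ (i⁻¹ * j) : Y →L[ℂ] Y) y)‖ ≤ ε) :
    ‖∑ i ∈ T, c i • (ρ i : X →L[ℂ] X) x‖ ^ 2 ≤
      ‖∑ i ∈ T, c i • (ζ i : Y →L[ℂ] Y) y‖ ^ 2 + (∑ i ∈ T, ∑ j ∈ T, ‖c i‖ * ‖c j‖) * ε := by
  rw [← sub_le_iff_le_add']
  refine (Real.le_norm_self _).trans ?_
  rw [← Complex.norm_real, Complex.ofReal_sub, norm_sq_sum_rep, norm_sq_sum_rep]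
  simp only [← Finset.sum_sub_distrib, Finset.sum_mul, ← mul_sub]
  refine (norm_sum_le _ _).trans (Finset.sum_le_sum fun i hi => ?_)
  refine (norm_sum_le _ _).trans (Finset.sum_le_sum fun j hj => ?_)
  rw [norm_mul, norm_mul, norm_star]
  exact mul_le_mul_of_nonneg_left (h i hi j hj) (by positivity)

end Cyclic

theorem HalfFiniteApproximationConjecture.norm_sum_le_min (h : HalfFiniteApproximationConjecture)
    {X : Type} [NormedAddCommGroup X] [InnerProductSpace ℂ X] [CompleteSpace X]
    (ρ : F₂ × F₂ →* unitary (X →L[ℂ] X)) (x : X) (hx : ‖x‖ = 1) (T : Finset (F₂ × F₂))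
    (c : F₂ × F₂ → ℂ) :
    ‖∑ i ∈ T, c i • (ρ i : X →L[ℂ] X) x‖ ≤
      (minSeminorm (FullGroupCStarAlgebra F₂) (FullGroupCStarAlgebra F₂)).toSeminorm
        (∑ i ∈ T, c i • ofTensor i) := by
  classical
  set m := (minSeminorm (FullGroupCStarAlgebra F₂) (FullGroupCStarAlgebra F₂)).toSeminorm
    (∑ i ∈ T, c i • ofTensor i) with hm
  have hm0 : 0 ≤ m := apply_nonneg _ _
  set C := ∑ i ∈ T, ∑ j ∈ T, ‖c i‖ * ‖c j‖ with hC
  have hC0 : 0 ≤ C := by positivity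
  refine le_of_sq_le_sq ?_ hm0
  refine le_of_forall_pos_le_add fun δ hδ => ?_
  -- `X` need not be separable, but the cyclic subspace of `x` is, and it carries the same matrix
  -- coefficients at `x`.
  let K := cyclicSubspace ρ x
  let ρ' := restrictUnitary ρ K (apply_mem_cyclicSubspace ρ x)
  let x' : K := ⟨x, mem_cyclicSubspace ρ x⟩
  let D := (T ×ˢ T).image fun q => q.1⁻¹ * q.2
  -- The conjecture takes a product of finite sets, so `D` is enclosed in the product of its
  -- projections. The tolerance makes the total error `C * (δ / (C + 1)) ≤ δ`; the `+ 1` allows for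
  -- `C = 0`.
  obtain ⟨Y, _, _, _, _, ζ, y, hζ, hy, happ⟩ := h K ρ' x' hx (D.image Prod.fst) (D.image Prod.snd)
    (δ / (C + 1)) (by positivity)
  have h1 := norm_sq_sum_rep_le_add ρ ζ x y T c (δ / (C + 1)) fun i hi j hj => by
    have hD : i⁻¹ * j ∈ D := Finset.mem_image.mpr ⟨(i, j), Finset.mk_mem_product hi hj, rfl⟩
    exact happ _ (Finset.mem_image_of_mem _ hD) _ (Finset.mem_image_of_mem _ hD)
  have h2 := norm_sum_le_min_of_isHalfFinite ζ hζ T c y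
  rw [hy, mul_one] at h2
  have h3 : C * (δ / (C + 1)) ≤ δ := by
    rw [← mul_div_assoc, div_le_iff₀ (by positivity)]
    nlinarith
  have h4 := pow_le_pow_left₀ (norm_nonneg _) h2 2
  linarith

theorem HalfFiniteApproximationConjecture.max_le_min (h : HalfFiniteApproximationConjecture)
    (T : Finset (F₂ × F₂)) (c : F₂ × F₂ → ℂ) :
    (maxSeminorm (FullGroupCStarAlgebra F₂) (FullGroupCStarAlgebra F₂)).toSeminorm
        (∑ i ∈ T, c i • ofTensor i) ≤
      (minSeminorm (FullGroupCStarAlgebra F₂) (FullGroupCStarAlgebra F₂)).toSeminorm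
        (∑ i ∈ T, c i • ofTensor i) := by
  -- As `F₂ : Type`, these representations act on spaces in `Type`, the universe of the conjecture.
  -- Unit vectors suffice for the operator norm.
  refine Real.iSup_le (fun π => ?_) (apply_nonneg _ _)
  refine ContinuousLinearMap.opNorm_le_of_unit_norm (apply_nonneg _ _) fun x hx => ?_
  refine le_trans (le_of_eq ?_) (h.norm_sum_le_min π.groupRep x hx T c)
  simp only [map_sum, map_smul, sum_apply, smul_apply, StarRep.groupRep_coe]

end

theorem mainTheorem2 (h : HalfFiniteApproximationConjecture) : ConnesEmbeddingConjecture := by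
  refine CStarSeminorm.exists_starAlgEquiv_of_eq (max_eq_min_of_le_span fun s hs => ?_)
  obtain ⟨c, rfl⟩ := Finsupp.mem_span_range_iff_exists_finsupp.mp hs
  exact h.max_le_min c.support c
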